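/- There exist a contraction $A$ (a bounded linear operator with $\|A\|\le 1$) and a bounded linear operator $S$ of rank $1$, acting on an infinite-dimensional complex Hilbert space $\mathcal K$, such that $A+S$ is hypercyclic, that is, for some $x\in\mathcal K$ the orbit $\{(A+S)^n x : n\ge 0\}$ is dense in $\mathcal K$. Moreover, they can be chosen as follows. Let $U$ be the unitary operator $Uf(z)=zf(z)$ on $L_2(\mathbb T)$, where $\mathbb T$ is the unit circle with normalized Lebesgue measure. There are $h,g\in L_2(\mathbb T)$ and a closed infinite-dimensional linear subspace $\mathcal K$ of $L_2(\mathbb T)$, invariant under $f\mapsto Uf+\langle f,g\rangle h$, such that, with $P$ the orthogonal projection of $L_2(\mathbb T)$ onto $\mathcal K$, the operators $Af=PUf$ and $Sf=\langle f,g\rangle Ph$ on $\mathcal K$ have the properties above. -/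

import Mathlib

open MeasureTheory
open scoped ENNReal

noncomputable section

/-- The Hilbert space `L₂(𝕋)` of the unit circle with normalized Lebesgue measure. The circle is
parametrized by `ℝ / ℤ`, the point `t` standing for `z = exp (2 π i t) = fourier 1 t`. -/
abbrev L2Circle : Type := Lp ℂ 2 (AddCircle.haarAddCircle : Measure UnitAddCircle)

lemma memLp_fourier_mul (n : ℤ) (f : L2Circle) :
    MemLp (fun t : UnitAddCircle => fourier n t * f t) 2 AddCircle.haarAddCircle := by
  refine (Lp.memLp f).of_le ((fourier n).continuous.aestronglyMeasurable.mul
    (Lp.memLp f).aestronglyMeasurable) (Filter.Eventually.of_forall fun t => ?_)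
  simp [Circle.norm_coe]

/-- Multiplication of a function in `L₂(𝕋)` by the monomial `z ^ n`. -/
def mulMonomial (n : ℤ) (f : L2Circle) : L2Circle := (memLp_fourier_mul n f).toLp _

lemma coeFn_mulMonomial (n : ℤ) (f : L2Circle) :
    mulMonomial n f =ᵐ[AddCircle.haarAddCircle] fun t => fourier n t * f t :=
  MemLp.coeFn_toLp _

lemma mulMonomial_neg_cancel (m n : ℤ) (h : m + n = 0) (f : L2Circle) :
    mulMonomial m (mulMonomial n f) = f := by
  apply Lp.ext
  filter_upwards [coeFn_mulMonomial m (mulMonomial n f), coeFn_mulMonomial n f] with t h1 h2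
  rw [h1, h2, ← mul_assoc, ← fourier_add, h, fourier_zero, one_mul]

/-- The unitary operator `U` on `L₂(𝕋)` of multiplication by the variable, `U f (z) = z f (z)`,
whose inverse is multiplication by `z⁻¹`. -/
def mulZ : L2Circle ≃ₗᵢ[ℂ] L2Circle where
  toFun := mulMonomial 1
  invFun := mulMonomial (-1)
  left_inv := mulMonomial_neg_cancel (-1) 1 (by norm_num)
  right_inv := mulMonomial_neg_cancel 1 (-1) (by norm_num)
  map_add' f g := by
    apply Lp.ext
    filter_upwards [coeFn_mulMonomial 1 (f + g), coeFn_mulMonomial 1 f, coeFn_mulMonomial 1 g,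
      Lp.coeFn_add f g, Lp.coeFn_add (mulMonomial 1 f) (mulMonomial 1 g)] with t h1 h2 h3 h4 h5
    rw [h1, h5, Pi.add_apply, h2, h3, h4, Pi.add_apply, mul_add]
  map_smul' c f := by
    apply Lp.ext
    filter_upwards [coeFn_mulMonomial 1 (c • f), coeFn_mulMonomial 1 f,
      Lp.coeFn_smul c f, Lp.coeFn_smul c (mulMonomial 1 f)] with t h1 h2 h3 h4
    simp only [RingHom.id_apply]
    rw [h1, h4, Pi.smul_apply, h2, h3, Pi.smul_apply, smul_eq_mul, smul_eq_mul, mul_left_comm]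
  norm_map' f := by
    apply le_antisymm <;> refine Lp.norm_le_norm_of_ae_le ?_ <;>
    · filter_upwards [coeFn_mulMonomial 1 f] with t h1
      simp only [LinearEquiv.coe_mk, LinearMap.coe_mk, AddHom.coe_mk]
      rw [h1]
      simp [Circle.norm_coe]

/-- The compression to a closed subspace `K` of a bounded operator `B` on a Hilbert space:
`x ↦ P (B x)` for `x ∈ K`, with `P` the orthogonal projection onto `K`. -/
def compression {H : Type*} [NormedAddCommGroup H] [InnerProductSpace ℂ H]
    (K : Submodule ℂ H) [K.HasOrthogonalProjection] (B : H →L[ℂ] H) : K →L[ℂ] K :=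
  K.orthogonalProjectionOnto ∘L B ∘L K.subtypeL

/-- A bounded operator `T` is hypercyclic if the orbit `{Tⁿ x : n ≥ 0}` of some vector is dense. -/
def IsHypercyclic {X : Type*} [NormedAddCommGroup X] [NormedSpace ℂ X] (T : X →L[ℂ] X) : Prop :=
  ∃ x : X, Dense (Set.range fun n : ℕ => (T ^ n) x)

end

/-!
The operator `T = U + ⟨·, g⟩ h` is made to have many eigenvectors with unimodular eigenvalues, and
`𝒦` is their closed span.

Let `g = z⁻¹` and `h(z) = -G(z⁻¹)`, where `G` belongs to the Hardy space and `G(0) = 1`. If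
`G(w) / (1 - λ w)` also belongs to the Hardy space, then `u_λ(z) = z⁻¹ G(z⁻¹) / (1 - λ z⁻¹)`
satisfies `⟨u_λ, g⟩ = 1` and `U u_λ + h = λ u_λ`, so that `T u_λ = λ u_λ`. Hence what is needed is
a `G` divisible in this sense by `1 - λ w` for all `λ` in an infinite set `Λ` of roots of unity
such that, for any finitely many `λ ∈ Λ`, there is an `n` for which `λ ^ n = 1` and each `λ` has a
twin `λ' ∈ Λ` with `λ' ^ n = -1` and `u_λ'` close to `u_λ`.
Such twins make `T` topologically transitive on the span of the eigenvectors, hence hypercyclic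
(`isHypercyclic_of_twin_eigenvectors`).

The function `G` is the limit in `L₂` of polynomials `G_k`, each obtained from the previous one by
a factor `F(w) = 1 - M⁻¹ ∑_{j = 1}^M (ω w) ^ (N j)` (`exists_twin_factor`), with all `λ` of stage
`k` being `N`-th roots of unity. This `F` satisfies `F(0) = 1`, vanishes at `(λ ω)⁻¹`, and
`F - 1` has `L₂` norm `M ^ (-1/2)`. After `M` is fixed, letting `ω → 1` along numbers with
`ω ^ n = -1`, `N ∣ n`, brings the eigenvectors for `λ` and its twin `λ ω` together.

A polynomial `p` stands for the function `p(z⁻¹) = p(U⁻¹) 1`; all estimates only use that the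
vectors `U⁻ⁿ 1`, `n ≥ 0`, are orthonormal. The compression `A` of `U` is a contraction, and `S`
is not `0`, since `A` alone has bounded orbits.
-/

open Polynomial Filter Topology

/-! ### Hypercyclicity from eigenvectors -/

/-- Birkhoff's transitivity theorem: by the Baire category theorem, a generic vector has
a dense orbit. -/
theorem exists_dense_orbit_of_transitive {X : Type*} [NormedAddCommGroup X] [NormedSpace ℂ X]
    [CompleteSpace X] [SecondCountableTopology X] (T : X →L[ℂ] X)
    (hT : ∀ W₁ W₂ : Set X, IsOpen W₁ → IsOpen W₂ → W₁.Nonempty → W₂.Nonempty →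
      ∃ z ∈ W₁, ∃ n : ℕ, (T ^ n) z ∈ W₂) : IsHypercyclic T := by
  obtain ⟨b, hbc, hbe, hb⟩ := TopologicalSpace.exists_countable_basis X
  have key : Dense (⋂ W ∈ b, ⋃ n : ℕ, (T ^ n) ⁻¹' W) := by
    refine dense_biInter_of_isOpen (fun W hW => ?_) hbc fun W hW => ?_
    · exact isOpen_iUnion fun n => (hb.isOpen hW).preimage (T ^ n).continuous
    · rw [dense_iff_inter_open]
      intro O hO hOne
      obtain ⟨z, hz, n, hn⟩ := hT O W hO (hb.isOpen hW) hOne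
        (Set.nonempty_iff_ne_empty.2 fun h => hbe (h ▸ hW))
      exact ⟨z, hz, Set.mem_iUnion.2 ⟨n, hn⟩⟩
  obtain ⟨x, hx⟩ := key.nonempty
  refine ⟨x, hb.dense_iff.2 fun W hW _ => ?_⟩
  obtain ⟨n, hn⟩ := Set.mem_iUnion.1 (Set.mem_iInter₂.1 hx W hW)
  exact ⟨_, hn, n, rfl⟩

/-- A hypercyclicity criterion. Suppose the eigenvectors `u i` of `T` span a dense subspace, and for
any finitely many of them there is a power `n` for which their eigenvalues satisfy `μ i ^ n = 1`,
while each `u i` has arbitrarily close to it a twin eigenvector `u j` with `μ j ^ n = -1`.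

With `τ i` the index of the twin, `z = ∑ (aᵢ + bᵢ) / 2 • u i + ∑ (aᵢ - bᵢ) / 2 • u (τ i)` is close
to `∑ aᵢ • u i`, and `Tⁿ z = ∑ (aᵢ + bᵢ) / 2 • u i - ∑ (aᵢ - bᵢ) / 2 • u (τ i)` is close to
`∑ bᵢ • u i`. -/
theorem isHypercyclic_of_twin_eigenvectors {X : Type*} [NormedAddCommGroup X] [NormedSpace ℂ X]
    [CompleteSpace X] (T : X →L[ℂ] X) {ι : Type*} [Countable ι] (u : ι → X)
    (μ : ι → ℂ) (hu : ∀ i, T (u i) = μ i • u i)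
    (hd : Dense (Submodule.span ℂ (Set.range u) : Set X))
    (htwin : ∀ s : Finset ι, ∀ ε > (0 : ℝ), ∃ n : ℕ, ∀ i ∈ s, μ i ^ n = 1 ∧
      ∃ j, μ j ^ n = -1 ∧ ‖u j - u i‖ ≤ ε) : IsHypercyclic T := by
  classical
  have : TopologicalSpace.SeparableSpace X := by
    have h := ((Set.countable_range u).isSeparable.span (R := ℂ)).closure
    rwa [hd.closure_eq, TopologicalSpace.isSeparable_univ_iff] at h
  have : SecondCountableTopology X := UniformSpace.secondCountable_of_separable X
  refine exists_dense_orbit_of_transitive T fun W₁ W₂ hW₁ hW₂ hne₁ hne₂ => ?_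
  obtain ⟨x, hx, hxs⟩ := hd.inter_open_nonempty W₁ hW₁ hne₁
  obtain ⟨y, hy, hys⟩ := hd.inter_open_nonempty W₂ hW₂ hne₂
  obtain ⟨a, rfl⟩ := (Finsupp.mem_span_range_iff_exists_finsupp).1 hxs
  obtain ⟨b, rfl⟩ := (Finsupp.mem_span_range_iff_exists_finsupp).1 hys
  obtain ⟨ε₁, hε₁, hB₁⟩ := Metric.isOpen_iff.1 hW₁ _ hx
  obtain ⟨ε₂, hε₂, hB₂⟩ := Metric.isOpen_iff.1 hW₂ _ hy
  set s := a.support ∪ b.support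
  rw [Finsupp.sum_of_support_subset a (Finset.subset_union_left : _ ⊆ s) _ (by simp)] at hB₁
  rw [Finsupp.sum_of_support_subset b (Finset.subset_union_right : _ ⊆ s) _ (by simp)] at hB₂
  set C : ℝ := ∑ i ∈ s, ‖(a i - b i) / 2‖
  have hC : 0 ≤ C := Finset.sum_nonneg fun i _ => norm_nonneg _
  have hpos : 0 < min ε₁ ε₂ / (C + 1) := div_pos (lt_min hε₁ hε₂) (by linarith)
  obtain ⟨n, hn⟩ := htwin s _ hpos
  choose! hn1 τ hτ hτu using hn
  have hpow : ∀ i (m : ℕ), (T ^ m) (u i) = μ i ^ m • u i := by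
    intro i m
    induction m with
    | zero => simp
    | succ m ih => rw [pow_succ', mul_apply_eq_comp, ih, map_smul, hu,
        smul_smul, pow_succ]
  -- The same error vector measures the distance from `z` to the first target and from `Tⁿ z` to
  -- the second one.
  set d : X := ∑ i ∈ s, ((a i - b i) / 2) • (u (τ i) - u i)
  have hd' : ‖d‖ < min ε₁ ε₂ := by
    calc ‖d‖ ≤ ∑ i ∈ s, ‖(a i - b i) / 2‖ * (min ε₁ ε₂ / (C + 1)) :=
          norm_sum_le_of_le _ fun i hi => by
            rw [norm_smul]; exact mul_le_mul_of_nonneg_left (hτu i hi) (norm_nonneg _)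
      _ = C * (min ε₁ ε₂ / (C + 1)) := by rw [Finset.sum_mul]
      _ < (C + 1) * (min ε₁ ε₂ / (C + 1)) := by gcongr; linarith
      _ = min ε₁ ε₂ := by field_simp
  refine ⟨∑ i ∈ s, (((a i + b i) / 2) • u i + ((a i - b i) / 2) • u (τ i)), hB₁ ?_, n, hB₂ ?_⟩
  · rw [Metric.mem_ball, dist_eq_norm, ← Finset.sum_sub_distrib]
    refine lt_of_eq_of_lt (congrArg _ (Finset.sum_congr rfl fun i _ => ?_))
      (hd'.trans_le (min_le_left _ _))
    rw [smul_sub]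
    module
  · rw [Metric.mem_ball, dist_eq_norm, map_sum, ← Finset.sum_sub_distrib, ← norm_neg,
      ← Finset.sum_neg_distrib]
    refine lt_of_eq_of_lt (congrArg _ (Finset.sum_congr rfl fun i hi => ?_))
      (hd'.trans_le (min_le_right _ _))
    rw [map_add, map_smul, map_smul, hpow, hpow, hn1 i hi, hτ i hi]
    module

/-! ### Polynomials in an isometry -/

/-- For an isometry `W`, the norm of `p(W)` is at most the `ℓ¹` norm of the
coefficients of `p`. -/
theorem norm_aeval_apply_le {E : Type*} [SeminormedAddCommGroup E] [NormedSpace ℂ E]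
    {W : E →ₗ[ℂ] E} (hW : ∀ x, ‖W x‖ = ‖x‖) (p : ℂ[X]) (x : E) :
    ‖aeval W p x‖ ≤ (p.sum fun _ a => ‖a‖) * ‖x‖ := by
  have hpow : ∀ n : ℕ, ‖(W ^ n) x‖ = ‖x‖ := by
    intro n
    induction n with
    | zero => simp
    | succ n ih => rw [pow_succ', Module.End.mul_apply, hW, ih]
  rw [aeval_eq_sum_range, LinearMap.sum_apply, sum_over_range _ (by simp), Finset.sum_mul]
  exact norm_sum_le_of_le _ fun i _ => by rw [LinearMap.smul_apply, norm_smul, hpow]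

theorem aeval_comp_C_mul_X {A : Type*} [Ring A] [Algebra ℂ A] (p : ℂ[X]) (ω : ℂ) (a : A) :
    aeval a (p.comp (C ω * X)) = aeval (ω • a) p := by
  rw [aeval_comp, map_mul, aeval_C, aeval_X, Algebra.smul_def]

/-- The average `M⁻¹ (X ^ N + X ^ (2 N) + ⋯ + X ^ (M N))`. It equals `1` at every `N`-th root of
unity, although its coefficients have `ℓ²` norm only `M ^ (-1/2)`. -/
noncomputable def averagePoly (N M : ℕ) : ℂ[X] :=
  C (M : ℂ)⁻¹ * ∑ j ∈ Finset.range M, X ^ (N * (j + 1))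

theorem coeff_zero_averagePoly {N : ℕ} (hN : 0 < N) (M : ℕ) : (averagePoly N M).coeff 0 = 0 := by
  rw [coeff_zero_eq_eval_zero, averagePoly, eval_mul, eval_finsetSum]
  simp [hN.ne']

theorem eval_averagePoly {N M : ℕ} (hM : 0 < M) {ζ : ℂ} (hζ : ζ ^ N = 1) :
    (averagePoly N M).eval ζ = 1 := by
  have : (M : ℂ) ≠ 0 := by exact_mod_cast hM.ne'
  rw [averagePoly, eval_mul, eval_finsetSum]
  simp [pow_mul, hζ, this]

/-- The polynomial `1 - lam X`. If `G` is divisible by it, the quotient gives an eigenvector with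
eigenvalue `lam`. -/
noncomputable def eigenFactor (lam : ℂ) : ℂ[X] := 1 - C lam * X

theorem eigenFactor_ne_zero (lam : ℂ) : eigenFactor lam ≠ 0 := fun h => by
  simpa [eigenFactor] using congrArg (fun p => p.eval 0) h

theorem eigenFactor_dvd {lam : ℂ} (hl : lam ≠ 0) {p : ℂ[X]} (hp : p.eval lam⁻¹ = 0) :
    eigenFactor lam ∣ p := by
  have h : eigenFactor lam = C (-lam) * (X - C lam⁻¹) := by
    rw [eigenFactor, mul_sub, ← C_mul, neg_mul, mul_inv_cancel₀ hl, C_neg, C_neg, C_1]; ring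
  rw [h]
  have hu : IsUnit (C (-lam)) := isUnit_C.2 (isUnit_iff_ne_zero.2 (neg_ne_zero.2 hl))
  exact (hu.mul_left_dvd).2 (dvd_iff_isRoot.2 hp)

section Wandering

variable {H : Type*} [NormedAddCommGroup H] [InnerProductSpace ℂ H] {V : H →ₗ[ℂ] H} {e : H}

theorem norm_aeval_averagePoly (he : Orthonormal ℂ fun n : ℕ => (V ^ n) e) {N : ℕ} (hN : 0 < N)
    (M : ℕ) {ω : ℂ} (hω : ‖ω‖ = 1) :
    ‖aeval (ω • V) (averagePoly N M) e‖ ^ 2 = (M : ℝ)⁻¹ := by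
  have hv : Orthonormal ℂ fun j : ℕ => (V ^ (N * (j + 1))) e :=
    he.comp (fun j : ℕ => N * (j + 1)) fun i j h => by simpa [hN.ne'] using h
  have h : aeval (ω • V) (averagePoly N M) e
      = ∑ j ∈ Finset.range M, ((M : ℂ)⁻¹ * ω ^ (N * (j + 1))) • (V ^ (N * (j + 1))) e := by
    simp only [averagePoly, C_mul', map_smul, map_sum, map_pow, aeval_X, _root_.smul_pow,
      Finset.smul_sum, LinearMap.sum_apply, LinearMap.smul_apply, smul_smul]
  have key := hv.inner_sum (fun j => (M : ℂ)⁻¹ * ω ^ (N * (j + 1)))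
    (fun j => (M : ℂ)⁻¹ * ω ^ (N * (j + 1))) (Finset.range M)
  rw [← h, inner_self_eq_norm_sq_to_K] at key
  have h2 : ∀ j : ℕ, (starRingEnd ℂ) ((M : ℂ)⁻¹ * ω ^ (N * (j + 1))) *
      ((M : ℂ)⁻¹ * ω ^ (N * (j + 1))) = ((M : ℂ)⁻¹) ^ 2 := by
    intro j
    rw [mul_comm, Complex.mul_conj, Complex.normSq_eq_norm_sq]
    simp [hω]
  simp only [h2, Finset.sum_const, Finset.card_range, nsmul_eq_mul] at key
  have : ((‖aeval (ω • V) (averagePoly N M) e‖ ^ 2 : ℝ) : ℂ) = ((M : ℝ)⁻¹ : ℝ) := by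
    push_cast
    refine key.trans ?_
    rcases eq_or_ne (M : ℂ) 0 with h0 | h0
    · simp [h0]
    · field_simp
  exact_mod_cast this

/-- Multiplication of `G` by a suitable `F` with `F(0) = 1` moves `G` and all quotients
`Q = G / (1 - lam X)`, `lam ^ N = 1`, by at most `ε`, and gives each `lam` a twin `lam * ω` whose
quotient is within `ε` of that of `lam`. Here `F(X) = 1 - averagePoly N M (ω X)`, where `M` is large
and then `ω = exp (π i / n)` is close to `1`; the difference of the two quotients is
`(ω - 1) lam X Q R`, with `R = F / (1 - lam ω X)` having coefficients bounded independently of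
`ω`. -/
theorem exists_twin_factor (hV : ∀ x, ‖V x‖ = ‖x‖) (he : Orthonormal ℂ fun n : ℕ => (V ^ n) e)
    {N : ℕ} (hN : 0 < N) (G : ℂ[X]) {ε : ℝ} (hε : 0 < ε) :
    ∃ (F : ℂ[X]) (n : ℕ) (ω : ℂ), 0 < n ∧ N ∣ n ∧ ω ^ n = -1 ∧ F.coeff 0 = 1 ∧
      ‖aeval V (G * F) e - aeval V G e‖ ≤ ε ∧
      ∀ (lam : ℂ) (Q : ℂ[X]), lam ^ N = 1 → G = eigenFactor lam * Q →
        ‖aeval V (Q * F) e - aeval V Q e‖ ≤ ε ∧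
        ∃ R, F = eigenFactor (lam * ω) * R ∧ ‖aeval V (G * R) e - aeval V (Q * F) e‖ ≤ ε := by
  have he1 : ‖e‖ = 1 := by simpa using he.1 0
  let l1 : ℂ[X] → ℝ := fun p => p.sum fun _ a => ‖a‖
  have hl1 : ∀ p, 0 ≤ l1 p := fun p => Finset.sum_nonneg fun i _ => norm_nonneg _
  have hmul : ∀ p q, ‖aeval V (p * q) e‖ ≤ l1 p * ‖aeval V q e‖ := fun p q => by
    rw [map_mul, Module.End.mul_apply]; exact norm_aeval_apply_le hV p _
  have hne : ∀ lam : ℂ, lam ^ N = 1 → lam ≠ 0 := by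
    rintro lam h rfl
    simp [hN.ne'] at h
  -- The quotients of `G` by the linear factors involved have uniformly bounded coefficients.
  let Z := nthRootsFinset N (1 : ℂ)
  have hZ : ∀ lam : ℂ, lam ^ N = 1 → lam ∈ Z := fun lam h => (mem_nthRootsFinset hN 1).2 h
  obtain ⟨B, hB0, hBG, hB⟩ :
      ∃ B : ℝ, 0 < B ∧ l1 G ≤ B ∧ ∀ lam ∈ Z, l1 (G / eigenFactor lam) ≤ B := by
    refine ⟨1 + l1 G + ∑ lam ∈ Z, l1 (G / eigenFactor lam), ?_, ?_, fun lam hlam => ?_⟩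
    · have := Finset.sum_nonneg fun lam (_ : lam ∈ Z) => hl1 (G / eigenFactor lam)
      have := hl1 G; linarith
    · have := Finset.sum_nonneg fun lam (_ : lam ∈ Z) => hl1 (G / eigenFactor lam)
      linarith
    · have := Finset.single_le_sum (fun lam (_ : lam ∈ Z) => hl1 (G / eigenFactor lam)) hlam
      have := hl1 G; linarith
  have hQB : ∀ lam Q, lam ^ N = 1 → G = eigenFactor lam * Q → l1 Q ≤ B := by
    rintro lam Q h1 h2
    have := hB lam (hZ lam h1)
    rwa [h2, mul_div_cancel_left₀ _ (eigenFactor_ne_zero lam)] at this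
  -- `M` controls the size of `F - 1`.
  obtain ⟨M, hM⟩ := exists_nat_gt ((B / ε) ^ 2)
  have hM0 : 0 < (M : ℝ) := (sq_nonneg _).trans_lt hM
  have hM0' : 0 < M := by exact_mod_cast hM0
  let F₀ : ℂ[X] := 1 - averagePoly N M
  choose! R hR using fun lam (h : lam ^ N = 1) => eigenFactor_dvd (hne lam h)
    (p := F₀) (by simp [F₀, eval_averagePoly (N := N) hM0' (ζ := lam⁻¹) (by simp [h])])
  obtain ⟨D, hD0, hD⟩ : ∃ D : ℝ, 0 < D ∧ ∀ lam ∈ Z, l1 (R lam) ≤ D := by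
    refine ⟨1 + ∑ lam ∈ Z, l1 (R lam), ?_, fun lam hlam => ?_⟩
    · have := Finset.sum_nonneg fun lam (_ : lam ∈ Z) => hl1 (R lam)
      linarith
    · have := Finset.single_le_sum (fun lam (_ : lam ∈ Z) => hl1 (R lam)) hlam
      linarith
  -- `ω` is a primitive `2n`-th root of unity, close to `1` because `n` is large.
  obtain ⟨l, hl⟩ : ∃ l : ℕ,
      ‖Complex.exp (Real.pi * Complex.I / ((N * (l + 1) : ℕ) : ℂ)) - 1‖ < ε / (B * D) := by
    have h1 : Tendsto (fun l : ℕ => N * (l + 1)) atTop atTop :=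
      tendsto_atTop_mono (fun l => (Nat.le_succ l).trans (Nat.le_mul_of_pos_left _ hN)) tendsto_id
    have h2 : Tendsto (fun l : ℕ => Real.pi * Complex.I / ((N * (l + 1) : ℕ) : ℂ)) atTop (𝓝 0) :=
      (tendsto_const_div_atTop_nhds_zero_nat (𝕜 := ℂ) (Real.pi * Complex.I)).comp h1
    have h3 := (Complex.continuous_exp.tendsto 0).comp h2
    rw [Complex.exp_zero] at h3
    obtain ⟨l, hl⟩ := (Metric.tendsto_nhds.1 h3 _ (div_pos hε (mul_pos hB0 hD0))).exists
    exact ⟨l, by simpa [dist_eq_norm] using hl⟩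
  set n := N * (l + 1) with hn
  have hn0 : 0 < n := Nat.mul_pos hN l.succ_pos
  set ω := Complex.exp (Real.pi * Complex.I / (n : ℂ)) with hω
  have hωn : ω ^ n = -1 := by
    have : (n : ℂ) ≠ 0 := by exact_mod_cast hn0.ne'
    rw [hω, ← Complex.exp_nat_mul, mul_div_cancel₀ _ this, Complex.exp_pi_mul_I]
  have hω1 : ‖ω‖ = 1 := by
    refine Complex.norm_eq_one_of_pow_eq_one (n := 2 * n) ?_ (by omega)
    rw [mul_comm, pow_mul, hωn]; norm_num
  have hωV : ∀ x, ‖(ω • V) x‖ = ‖x‖ := fun x => by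
    rw [LinearMap.smul_apply, norm_smul, hω1, one_mul, hV]
  let F : ℂ[X] := F₀.comp (C ω * X)
  have hF1 : ‖aeval V (F - 1) e‖ ≤ ε / B := by
    have h1 : aeval V (F - 1) e = - aeval (ω • V) (averagePoly N M) e := by
      simp [F, F₀, aeval_comp_C_mul_X]
    rw [h1, norm_neg]
    refine (pow_le_pow_iff_left₀ (norm_nonneg _) (div_pos hε hB0).le two_ne_zero).1 ?_
    rw [norm_aeval_averagePoly he hN M hω1]
    refine inv_le_of_inv_le₀ (by positivity) ?_
    rw [← inv_pow, inv_div]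
    exact hM.le
  have hsmall : ∀ p, l1 p ≤ B → ‖aeval V (p * F) e - aeval V p e‖ ≤ ε := by
    intro p hp
    have h1 : aeval V (p * F) e - aeval V p e = aeval V (p * (F - 1)) e := by
      rw [mul_sub, mul_one, map_sub, LinearMap.sub_apply]
    rw [h1]
    calc _ ≤ l1 p * ‖aeval V (F - 1) e‖ := hmul _ _
      _ ≤ B * (ε / B) := mul_le_mul hp hF1 (norm_nonneg _) hB0.le
      _ = ε := by field_simp
  have hFR : ∀ lam, lam ^ N = 1 → F = eigenFactor (lam * ω) * (R lam).comp (C ω * X) := by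
    intro lam hlam
    have := congrArg (fun p => p.comp (C ω * X)) (hR lam hlam)
    simp only [F, this, eigenFactor, mul_comp, sub_comp, one_comp, C_comp, X_comp, C_mul,
      mul_assoc]
  refine ⟨F, n, ω, hn0, ⟨l + 1, hn⟩, hωn, ?_, hsmall G hBG, fun lam Q hlam hG =>
    ⟨hsmall Q (hQB lam Q hlam hG), (R lam).comp (C ω * X), hFR lam hlam, ?_⟩⟩
  · have := coeff_zero_averagePoly hN M
    rw [coeff_zero_eq_eval_zero] at this ⊢
    simp [F, F₀, this]
  · have hdiff : G * (R lam).comp (C ω * X) - Q * F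
        = C (lam * (ω - 1)) * (X * (Q * (R lam).comp (C ω * X))) := by
      rw [hFR lam hlam, hG]; simp only [eigenFactor, C_mul, C_sub, C_1]; ring
    have hlam1 : ‖lam‖ = 1 := Complex.norm_eq_one_of_pow_eq_one hlam hN.ne'
    have hRn : ‖aeval V ((R lam).comp (C ω * X)) e‖ ≤ D := by
      rw [aeval_comp_C_mul_X]
      refine (norm_aeval_apply_le hωV _ _).trans ?_
      rw [he1, mul_one]
      exact hD lam (hZ lam hlam)
    rw [← LinearMap.sub_apply, ← map_sub, hdiff, C_mul', map_smul, LinearMap.smul_apply, norm_smul,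
      map_mul, aeval_X, Module.End.mul_apply, hV, norm_mul, hlam1, one_mul]
    calc _ ≤ ε / (B * D) * (B * D) := by
          refine mul_le_mul hl.le ((hmul _ _).trans ?_) (norm_nonneg _) (by positivity)
          exact mul_le_mul (hQB lam Q hlam hG) hRn (norm_nonneg _) hB0.le
      _ = ε := by field_simp

/-- Pairing with the wandering vector `e` is evaluation of the polynomial at `0`. -/
theorem inner_aeval_eq_coeff_zero (he : Orthonormal ℂ fun n : ℕ => (V ^ n) e) (p : ℂ[X]) :
    inner ℂ e (aeval V p e) = p.coeff 0 := by
  have h : ∀ n : ℕ, inner ℂ e ((V ^ n) e) = if n = 0 then (1 : ℂ) else 0 := fun n => by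
    simpa [eq_comm] using (orthonormal_iff_ite.1 he) 0 n
  rw [aeval_eq_sum_range, LinearMap.sum_apply, inner_sum]
  simp [inner_smul_right, h]

/-! ### Construction of the eigenvectors -/

/-- The sequence of polynomials obtained by iterating `exists_twin_factor`. The eigenvalues
available at stage `k` are the `lam` with `lam ^ N k = 1` and `1 - lam X ∣ G k`; they stay available, and each
gets a twin at stage `k + 1`. -/
theorem exists_twin_sequence (hV : ∀ x, ‖V x‖ = ‖x‖) (he : Orthonormal ℂ fun n : ℕ => (V ^ n) e) :
    ∃ (N n : ℕ → ℕ) (G : ℕ → ℂ[X]), (∀ k, 0 < N k) ∧ (∀ k, (G k).coeff 0 = 1) ∧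
      G 0 = eigenFactor 1 ∧
      (∀ k, ‖aeval V (G (k + 1)) e - aeval V (G k) e‖ ≤ (1 / 2) ^ k) ∧
      ∀ k lam, lam ^ N k = 1 → eigenFactor lam ∣ G k →
        lam ^ N (k + 1) = 1 ∧ eigenFactor lam ∣ G (k + 1) ∧
        ‖aeval V (G (k + 1) / eigenFactor lam) e - aeval V (G k / eigenFactor lam) e‖
          ≤ (1 / 2) ^ k ∧
        lam ^ n k = 1 ∧
        ∃ lam', lam' ^ N (k + 1) = 1 ∧ eigenFactor lam' ∣ G (k + 1) ∧ lam' ^ n k = -1 ∧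
          ‖aeval V (G (k + 1) / eigenFactor lam') e - aeval V (G (k + 1) / eigenFactor lam) e‖
            ≤ (1 / 2) ^ k := by
  let State := {s : ℕ × ℂ[X] // 0 < s.1 ∧ s.2.coeff 0 = 1}
  have step : ∀ (k : ℕ) (s : State), ∃ (n : ℕ) (t : State),
      ‖aeval V t.1.2 e - aeval V s.1.2 e‖ ≤ (1 / 2) ^ k ∧
      ∀ lam, lam ^ s.1.1 = 1 → eigenFactor lam ∣ s.1.2 →
        lam ^ t.1.1 = 1 ∧ eigenFactor lam ∣ t.1.2 ∧
        ‖aeval V (t.1.2 / eigenFactor lam) e - aeval V (s.1.2 / eigenFactor lam) e‖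
          ≤ (1 / 2) ^ k ∧
        lam ^ n = 1 ∧
        ∃ lam', lam' ^ t.1.1 = 1 ∧ eigenFactor lam' ∣ t.1.2 ∧ lam' ^ n = -1 ∧
          ‖aeval V (t.1.2 / eigenFactor lam') e - aeval V (t.1.2 / eigenFactor lam) e‖
            ≤ (1 / 2) ^ k := by
    rintro k ⟨⟨N, G⟩, hN, hG⟩
    obtain ⟨F, n, ω, hn, ⟨m, hm⟩, hω, hF, hGF, hQ⟩ :=
      exists_twin_factor hV he hN G (ε := (1 / 2) ^ k) (by positivity)
    refine ⟨n, ⟨⟨n * 2, G * F⟩, by positivity, ?_⟩, hGF, fun lam hlam hdvd => ?_⟩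
    · rw [mul_coeff_zero, hF, mul_one]; exact hG
    · obtain ⟨Q, hGQ⟩ := hdvd
      simp only at hlam hGQ
      obtain ⟨h1, R, hR, h2⟩ := hQ lam Q hlam hGQ
      have hlamn : lam ^ n = 1 := by rw [hm, pow_mul, hlam, one_pow]
      have hω' : (lam * ω) ^ n = -1 := by rw [mul_pow, hlamn, hω, one_mul]
      have e1 : G / eigenFactor lam = Q := by
        rw [hGQ, mul_div_cancel_left₀ _ (eigenFactor_ne_zero lam)]
      have hGF1 : G * F = eigenFactor lam * (Q * F) := by rw [hGQ, mul_assoc]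
      have e2 : G * F / eigenFactor lam = Q * F := by
        rw [hGF1, mul_div_cancel_left₀ _ (eigenFactor_ne_zero lam)]
      have hGF2 : G * F = eigenFactor (lam * ω) * (G * R) := by
        rw [hR, eigenFactor]; ring
      have e3 : G * F / eigenFactor (lam * ω) = G * R := by
        rw [hGF2, mul_div_cancel_left₀ _ (eigenFactor_ne_zero _)]
      refine ⟨by simp only [pow_mul, hlamn, one_pow], ⟨_, hGF1⟩, ?_, hlamn, lam * ω,
        by simp only [pow_mul, hω']; norm_num, ⟨_, hGF2⟩, hω', ?_⟩
      · simp only [e1, e2]; exact h1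
      · simp only [e2, e3]; exact h2
  choose n t ht using step
  let s : ℕ → State := fun k => Nat.rec
    ⟨⟨1, eigenFactor 1⟩, one_pos, by simp [eigenFactor]⟩ (fun k s => t k s) k
  exact ⟨fun k => (s k).1.1, fun k => n k (s k), fun k => (s k).1.2, fun k => (s k).2.1,
    fun k => (s k).2.2, rfl, fun k => (ht k (s k)).1, fun k => (ht k (s k)).2⟩

/-- Eigenvectors of the rank one perturbation `x ↦ V⁻¹ x + ⟪V e, x⟫ h` of `V⁻¹`, normalized by
`⟪V e, u lam⟫ = 1`. In the notation of `exists_twin_sequence`, `h` is the limit of `-G k (V) e` and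
`u lam` the limit of `V (G k / (1 - lam X))(V) e`. The equation `V⁻¹ (u lam) + h = lam • u lam` is
the limit of `(1 - lam X) * (G k / (1 - lam X)) = G k`. -/
theorem exists_twin_eigenvectors [CompleteSpace H] (V : H ≃ₗᵢ[ℂ] H)
    (he : Orthonormal ℂ fun n : ℕ => ((V : H →ₗ[ℂ] H) ^ n) e) :
    ∃ (h : H) (Λ : Set ℂ) (u : ℂ → H), Λ.Countable ∧ Λ.Nonempty ∧
      (∀ lam ∈ Λ, inner ℂ (V e) (u lam) = 1 ∧ V.symm (u lam) + h = lam • u lam) ∧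
      ∀ s : Finset ℂ, ↑s ⊆ Λ → ∀ ε > (0 : ℝ), ∃ n : ℕ, ∀ lam ∈ s, lam ^ n = 1 ∧
        ∃ lam' ∈ Λ, lam' ^ n = -1 ∧ ‖u lam' - u lam‖ ≤ ε := by
  set V₀ : H →ₗ[ℂ] H := (V : H →ₗ[ℂ] H) with hV₀
  have hVa : ∀ x, V₀ x = V x := fun x => rfl
  obtain ⟨N, n, G, hN, hG, hG0, hGd, hstep⟩ :=
    exists_twin_sequence (V := V₀) (fun x => V.norm_map x) he
  let node : ℕ → ℂ → Prop := fun k lam => lam ^ N k = 1 ∧ eigenFactor lam ∣ G k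
  let q : ℂ → ℕ → H := fun lam k => aeval V₀ (G k / eigenFactor lam) e
  have hnode_add : ∀ k lam, node k lam → ∀ j, node (k + j) lam := by
    intro k lam hk j
    induction j with
    | zero => exact hk
    | succ j ih => exact ⟨(hstep _ lam ih.1 ih.2).1, (hstep _ lam ih.1 ih.2).2.1⟩
  have hdist : ∀ k lam, node k lam → ∀ j,
      dist (q lam (k + j)) (q lam (k + (j + 1))) ≤ (1 / 2) ^ k * (1 / 2 : ℝ) ^ j := by
    intro k lam hk j
    have hj := hnode_add k lam hk j
    rw [dist_comm, dist_eq_norm, ← pow_add]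
    exact (hstep _ lam hj.1 hj.2).2.2.1
  obtain ⟨γ, hγ⟩ : ∃ γ, Tendsto (fun k => aeval V₀ (G k) e) atTop (𝓝 γ) := by
    refine cauchySeq_tendsto_of_complete
      (cauchySeq_of_le_geometric (1 / 2) 1 (by norm_num) fun k => ?_)
    rw [dist_comm, dist_eq_norm, one_mul]
    exact hGd k
  have hlim : ∀ lam, (∃ k, node k lam) → ∃ w, Tendsto (q lam) atTop (𝓝 w) := by
    rintro lam ⟨k, hk⟩
    obtain ⟨w, hw⟩ := cauchySeq_tendsto_of_complete
      (cauchySeq_of_le_geometric (1 / 2) _ (by norm_num) (hdist k lam hk))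
    refine ⟨w, (tendsto_add_atTop_iff_nat k).1 ?_⟩
    simpa only [add_comm k] using hw
  choose! w hw using hlim
  have hwd : ∀ k lam, node k lam → ‖q lam k - w lam‖ ≤ 2 * (1 / 2) ^ k := by
    intro k lam hk
    have h1 : Tendsto (fun j => q lam (k + j)) atTop (𝓝 (w lam)) := by
      simpa only [add_comm k] using (tendsto_add_atTop_iff_nat k).2 (hw lam ⟨k, hk⟩)
    have := dist_le_of_le_geometric_of_tendsto₀ (1 / 2) _ (by norm_num) (hdist k lam hk) h1
    rw [dist_eq_norm] at this
    refine this.trans_eq ?_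
    ring
  refine ⟨-γ, {lam | ∃ k, node k lam}, fun lam => V (w lam), ?_, ⟨1, 0, ?_, ?_⟩, ?_, ?_⟩
  · rw [Set.ofPred_exists]
    refine Set.countable_iUnion fun k => Set.Countable.mono (s₂ := nthRootsFinset (N k) (1 : ℂ))
      (fun lam h => ?_) (Finset.countable_toSet _)
    exact (mem_nthRootsFinset (hN k) 1).2 h.1
  · exact one_pow _
  · rw [hG0]
  · rintro lam ⟨k, hk⟩
    have hmul : ∀ j, eigenFactor lam * (G (j + k) / eigenFactor lam) = G (j + k) := fun j =>
      EuclideanDomain.mul_div_cancel' (eigenFactor_ne_zero lam)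
        (by rw [add_comm]; exact (hnode_add k lam hk j).2)
    have hwk := (tendsto_add_atTop_iff_nat k).2 (hw lam ⟨k, hk⟩)
    constructor
    · rw [V.inner_map_map]
      have h1 : Tendsto (fun j => inner ℂ e (q lam (j + k))) atTop (𝓝 (inner ℂ e (w lam))) :=
        tendsto_const_nhds.inner hwk
      refine tendsto_nhds_unique h1 (tendsto_const_nhds.congr fun j => ?_)
      have h2 := congrArg (fun p => p.coeff 0) (hmul j)
      simp only [mul_coeff_zero, hG] at h2
      rw [inner_aeval_eq_coeff_zero he]
      simpa [eigenFactor] using h2.symm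
    · have h1 : Tendsto (fun j => q lam (j + k) - lam • V (q lam (j + k))) atTop
          (𝓝 (w lam - lam • V (w lam))) :=
        hwk.sub ((V.continuous.tendsto _).comp hwk |>.const_smul lam)
      have h2 := (tendsto_add_atTop_iff_nat k).2 hγ
      have h3 : w lam - lam • V (w lam) = γ := by
        refine tendsto_nhds_unique h1 (h2.congr fun j => ?_)
        have h4 := congrArg (fun p => aeval V₀ p e) (hmul j)
        rw [← h4]
        simp [eigenFactor, q, hVa, sub_mul]
      rw [V.symm_apply_apply, ← h3]
      abel
  · intro s hs ε hε
    obtain ⟨K, hK⟩ : ∃ K, ∀ lam ∈ s, node K lam := by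
      choose! κ hκ using fun lam (hl : lam ∈ s) => Set.mem_ofPred_eq ▸ hs hl
      refine ⟨s.sup κ, fun lam hl => ?_⟩
      have := hnode_add _ lam (hκ lam hl) (s.sup κ - κ lam)
      rwa [Nat.add_sub_cancel' (Finset.le_sup hl)] at this
    obtain ⟨j, hj⟩ := exists_pow_lt_of_lt_one (show 0 < ε / 3 by positivity)
      (show (1 / 2 : ℝ) < 1 by norm_num)
    set k := K + j with hk
    have hkε : (1 / 2 : ℝ) ^ k ≤ ε / 3 :=
      (pow_le_pow_of_le_one (by norm_num) (by norm_num) (Nat.le_add_left j K)).trans hj.le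
    refine ⟨n k, fun lam hl => ?_⟩
    have hnk : node k lam := hnode_add K lam (hK lam hl) j
    obtain ⟨h1, h2, -, h3, lam', h4, h5, h6, h7⟩ := hstep k lam hnk.1 hnk.2
    refine ⟨h3, lam', ⟨k + 1, h4, h5⟩, h6, ?_⟩
    have d1 := hwd (k + 1) lam ⟨h1, h2⟩
    have d2 := hwd (k + 1) lam' ⟨h4, h5⟩
    rw [← map_sub, V.norm_map]
    calc ‖w lam' - w lam‖
        = ‖-(q lam' (k + 1) - w lam') + (q lam' (k + 1) - q lam (k + 1))
            + (q lam (k + 1) - w lam)‖ := by congr 1; abel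
      _ ≤ 2 * (1 / 2) ^ (k + 1) + (1 / 2) ^ k + 2 * (1 / 2) ^ (k + 1) := by
          refine norm_add₃_le.trans (add_le_add (add_le_add ?_ h7) d1)
          rwa [norm_neg]
      _ = 3 * (1 / 2) ^ k := by ring
      _ ≤ ε := by linarith

end Wandering

/-! ### The hypercyclic perturbation -/

/-- The statement for an arbitrary unitary `U` for which `U⁻¹` has a unit wandering vector `e`. The
subspace `K` is the closed span of the eigenvectors of `U + ⟪·, g⟫ h`, with `g = U⁻¹ e`. -/
theorem exists_hypercyclic_rank_one_perturbation {H : Type*} [NormedAddCommGroup H]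
    [InnerProductSpace ℂ H] [CompleteSpace H] (U : H ≃ₗᵢ[ℂ] H) (e : H)
    (he : Orthonormal ℂ fun n : ℕ => ((U.symm : H →ₗ[ℂ] H) ^ n) e) :
    ∃ (h g : H) (K : Submodule ℂ H) (_ : IsClosed (K : Set H))
      (_ : K.HasOrthogonalProjection) (A S : K →L[ℂ] K),
      ¬ FiniteDimensional ℂ K ∧
      (∀ f ∈ K, U f + inner ℂ g f • h ∈ K) ∧
      A = compression K (U : H →L[ℂ] H) ∧
      S = compression K (InnerProductSpace.rankOne ℂ h g) ∧
      ‖A‖ ≤ 1 ∧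
      (S : K →ₗ[ℂ] K).rank = 1 ∧
      IsHypercyclic (A + S) := by
  obtain ⟨h, Λ, u, hΛc, ⟨l₀, hl₀⟩, hu, htwin⟩ := exists_twin_eigenvectors U.symm he
  rw [LinearIsometryEquiv.symm_symm] at hu
  set g := U.symm e
  set K : Submodule ℂ H := (Submodule.span ℂ (u '' Λ)).topologicalClosure with hK
  have hKc : IsClosed (K : Set H) := Submodule.isClosed_topologicalClosure _
  have : CompleteSpace K := hKc.completeSpace_coe
  have huK : ∀ lam ∈ Λ, u lam ∈ K := fun lam hl =>
    Submodule.le_topologicalClosure _ (Submodule.subset_span ⟨lam, hl, rfl⟩)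
  let v : Λ → K := fun lam => ⟨u lam, huK lam lam.2⟩
  have hv0 : ∀ lam, v lam ≠ 0 := fun lam h0 => by
    have h1 := (hu lam lam.2).1
    rw [show u lam = 0 from congrArg Subtype.val h0, inner_zero_right] at h1
    exact zero_ne_one h1
  set A := compression K (U : H →L[ℂ] H) with hA
  set S := compression K (InnerProductSpace.rankOne ℂ h g) with hS
  set p : K := K.orthogonalProjectionOnto h with hp
  have hSapp : ∀ x : K, S x = inner ℂ g (x : H) • p := fun x => by
    simp [hS, compression, hp]
  have heig : ∀ lam : Λ, (A + S) (v lam) = (lam : ℂ) • v lam := fun lam => by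
    have h1 : (A + S) (v lam)
        = K.orthogonalProjectionOnto (U (u lam) + inner ℂ g (u lam) • h) := by
      rw [add_apply, hSapp, map_add, map_smul]
      rfl
    rw [h1, (hu lam lam.2).1, one_smul, (hu lam lam.2).2]
    exact K.orthogonalProjectionOnto_mem_subspace_eq_self ((lam : ℂ) • v lam)
  have hdense : Dense (Submodule.span ℂ (Set.range v) : Set K) := by
    rw [Subtype.dense_iff]
    have h1 : (Subtype.val '' (Submodule.span ℂ (Set.range v) : Set K) : Set H)
        = Submodule.span ℂ (u '' Λ) := by
      have : (Submodule.span ℂ (Set.range v)).map K.subtype = Submodule.span ℂ (u '' Λ) := by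
        rw [Submodule.map_span, ← Set.range_comp, Set.image_eq_range]
        rfl
      rw [← this]
      rfl
    exact (congrArg closure h1).ge
  have hhyp : IsHypercyclic (A + S) := by
    have : Countable Λ := hΛc.to_subtype
    refine isHypercyclic_of_twin_eigenvectors (A + S) v (fun lam => lam) heig hdense
      fun s ε hε => ?_
    obtain ⟨n, hn⟩ := htwin (s.map (Function.Embedding.subtype _))
      (by intro x hx; simp at hx; exact hx.1) ε hε
    refine ⟨n, fun i hi => ?_⟩
    obtain ⟨h1, l', hl', h2, h3⟩ := hn i (Finset.mem_map_of_mem _ hi)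
    exact ⟨h1, ⟨l', hl'⟩, h2, h3⟩
  have hAle : ∀ x, ‖A x‖ ≤ ‖x‖ := fun x =>
    (K.norm_orthogonalProjectionOnto_apply_le (U x)).trans_eq (U.norm_map x)
  have hA1 : ‖A‖ ≤ 1 :=
    ContinuousLinearMap.opNorm_le_bound _ zero_le_one fun x => by rw [one_mul]; exact hAle x
  -- If `P h = 0`, then `A + S = A` is a contraction, and its orbits are bounded.
  have hp0 : p ≠ 0 := by
    intro hp0
    have hAS : A + S = A := by
      ext1 x
      rw [add_apply, hSapp, hp0, smul_zero, add_zero]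
    obtain ⟨x, hx⟩ := hhyp
    rw [hAS] at hx
    have hb : ∀ n : ℕ, ‖(A ^ n) x‖ ≤ ‖x‖ := fun n => by
      induction n with
      | zero => simp
      | succ n ih => rw [pow_succ', mul_apply_eq_comp]; exact (hAle _).trans ih
    have hall : ∀ y : K, ‖y‖ ≤ ‖x‖ := fun y => by
      have h1 : closure (Set.range fun n : ℕ => (A ^ n) x) ⊆ Metric.closedBall 0 ‖x‖ :=
        closure_minimal (by rintro _ ⟨n, rfl⟩; simpa using hb n) Metric.isClosed_closedBall
      simpa using h1 (hx y)
    obtain ⟨c, hc⟩ := NormedField.exists_lt_norm ℂ (‖x‖ / ‖v ⟨l₀, hl₀⟩‖)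
    rw [div_lt_iff₀ (norm_pos_iff.2 (hv0 _)), ← norm_smul] at hc
    exact absurd (hall _) (not_le.2 hc)
  have hSv : S (v ⟨l₀, hl₀⟩) = p := by
    rw [hSapp]
    exact (congrArg (· • p) (hu l₀ hl₀).1).trans (one_smul _ _)
  refine ⟨h, g, K, hKc, inferInstance, A, S, ?_, ?_, rfl, rfl, hA1, ?_, hhyp⟩
  · intro hfin
    have hli : LinearIndependent ℂ v :=
      Module.End.eigenvectors_linearIndependent' ((A + S : K →L[ℂ] K) : K →ₗ[ℂ] K)
        (fun lam : Λ => (lam : ℂ)) Subtype.val_injective v fun lam =>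
        ⟨Module.End.mem_eigenspace_iff.2 (heig lam), hv0 lam⟩
    have hΛf : Finite Λ := hli.finite
    -- In a finite `Λ` all `λ` would satisfy `λ ^ n = 1` for one `n`, and none `λ ^ n = -1`.
    obtain ⟨n, hn⟩ := htwin (Set.toFinite Λ).toFinset (by simp) 1 one_pos
    obtain ⟨-, l', hl', h2, -⟩ := hn l₀ (by simpa using hl₀)
    have h1 := (hn l' (by simpa using hl')).1
    rw [h1] at h2
    norm_num at h2
  · let T : H →L[ℂ] H := (U : H →L[ℂ] H) + InnerProductSpace.rankOne ℂ h g
    have hle : K ≤ K.comap (T : H →ₗ[ℂ] H) := by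
      refine Submodule.topologicalClosure_minimal _ (Submodule.span_le.2 ?_)
        (hKc.preimage T.continuous)
      rintro _ ⟨lam, hl, rfl⟩
      have h1 : T (u lam) = lam • u lam := by
        rw [← (hu lam hl).2]
        simp [T, (hu lam hl).1]
      change T (u lam) ∈ K
      rw [h1]
      exact K.smul_mem _ (huK lam hl)
    exact fun f hf => hle hf
  · refine rank_eq_one (⟨p, v ⟨l₀, hl₀⟩, hSv⟩ : LinearMap.range (S : K →ₗ[ℂ] K))
      (fun h0 => hp0 (congrArg Subtype.val h0)) ?_
    rintro ⟨_, x, rfl⟩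
    exact ⟨inner ℂ g (x : H), Subtype.ext (hSapp x).symm⟩

/-! ### The bilateral shift on `L₂(𝕋)` -/

theorem mulZ_symm_fourierLp (n : ℤ) :
    mulZ.symm (fourierLp 2 n) = (fourierLp 2 (n - 1) : L2Circle) := by
  change mulMonomial (-1) _ = _
  apply Lp.ext
  filter_upwards [coeFn_mulMonomial (-1) (fourierLp 2 n), coeFn_fourierLp (T := 1) 2 n,
    coeFn_fourierLp (T := 1) 2 (n - 1)] with t h1 h2 h3
  rw [h1, h2, h3, ← fourier_add, neg_add_eq_sub]

theorem orthonormal_mulZ_symm_pow :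
    Orthonormal ℂ fun n : ℕ => ((mulZ.symm : L2Circle →ₗ[ℂ] L2Circle) ^ n) (fourierLp 2 0) := by
  have h : ∀ n : ℕ, ((mulZ.symm : L2Circle →ₗ[ℂ] L2Circle) ^ n) (fourierLp 2 0)
      = fourierLp 2 (-(n : ℤ)) := by
    intro n
    induction n with
    | zero => simp
    | succ n ih =>
      rw [pow_succ', Module.End.mul_apply, ih]
      refine (mulZ_symm_fourierLp _).trans ?_
      congr 1
      push_cast; ring
  simp only [h]
  exact orthonormal_fourier.comp (fun n : ℕ => -(n : ℤ)) fun a b hab => by simpa using hab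

theorem corollary2 :
    ∃ (h g : L2Circle) (K : Submodule ℂ L2Circle) (_ : IsClosed (K : Set L2Circle))
      (_ : K.HasOrthogonalProjection) (A S : K →L[ℂ] K),
      -- `K` is an infinite-dimensional Hilbert space, invariant under `U + ⟨·, g⟩ h`
      ¬ FiniteDimensional ℂ K ∧
      (∀ f ∈ K, mulZ f + inner ℂ g f • h ∈ K) ∧
      -- `A` and `S` are the compressions to `K` of `U` and of `⟨·, g⟩ h`
      A = compression K (mulZ : L2Circle →L[ℂ] L2Circle) ∧
      S = compression K (InnerProductSpace.rankOne ℂ h g) ∧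
      -- `A` is a contraction, `S` has rank one, and `A + S` is hypercyclic
      ‖A‖ ≤ 1 ∧
      (S : K →ₗ[ℂ] K).rank = 1 ∧
      IsHypercyclic (A + S) :=
  exists_hypercyclic_rank_one_perturbation mulZ (fourierLp 2 0) orthonormal_mulZ_symm_pow
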